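/- All vector spaces are real. For a diffeological space $X$, let $D(X)$ denote its underlying set with the $D$-topology, the finest topology making every plot continuous. A diffeological vector space is a vector space with a diffeology for which addition $V\times V\to V$ and scalar multiplication $\mathbb{R}\times V\to V$ are smooth. For a diffeological space $X$, the free diffeological vector space $F(X)$ is the vector space $\bigoplus_{x\in X}\mathbb{R}$ with the diffeology generated by the maps $(\mathbb{R}\times X)^k\to F(X)$, $(r_1,x_1,\dots,r_k,x_k)\mapsto\sum_{i=1}^k r_i[x_i]$, $k\ge 1$. A direct sum $\bigoplus_{i\in I}V_i$ of diffeological vector spaces carries the diffeology generated by the canonical maps $\prod_{j\in J}V_j\to\bigoplus_{i\in I}V_i$ with $J\subseteq I$ finite. A diffeological vector space $P$ is projective if for every linear subduction $q:V\to W$ of diffeological vector spaces and every smooth linear map $f:P\to W$ there is a smooth linear map $g:P\to V$ with $q\circ g=f$. A projective diffeological vector space $P$ is countably-generated if it is a smooth direct summand of a countable direct sum $V=\bigoplus_i F(U_i)$ with each $U_i$ an open subset of some Euclidean space, that is, $V\cong P\times Q$ as diffeological vector spaces for some diffeological vector space $Q$. A $k_\omega$-space is a Hausdorff space $X$ with a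 countable cover $\{K_n : n\in\mathbb{N}\}$ by compact subsets such that a set $A\subseteq X$ is closed if and only if $A\cap K_n$ is closed in $K_n$ for every $n$. **Theorem.** For every countably-generated projective diffeological vector space $P$, the space $D(P)$ is a $k_\omega$-space (hence $T_1$ and normal), $D(P)$ is a topological vector space, and $D(P\times P)=D(P)\times D(P)$, i.e. the $D$-topology of the product diffeology on $P\times P$ is the product topology. -/

import Mathlib

open Diffeology

/-! ### Basic constructions of diffeologies -/

namespace DiffeologicalSpace

/-- The diffeology on `X` induced by a map `f : X → Y`: its plots are the maps whose composite
with `f` is a plot of `Y`. -/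
@[reducible]
def induced {X Y : Type*} [DiffeologicalSpace Y] (f : X → Y) : DiffeologicalSpace X where
  plots n := {p | IsPlot (f ∘ p)}
  constant_plots x := isPlot_const (x := f x)
  plot_reparam hp hf := isPlot_reparam hp hf
  locality {n p} hp := by
    refine DiffeologicalSpace.locality fun x ↦ ?_
    obtain ⟨u, hu, hx, h⟩ := hp x
    exact ⟨u, hu, hx, fun {m g} hg hg' ↦ h hg hg'⟩

/-- The diffeology on `Y` coinduced by a map `f : X → Y`: the finest diffeology on `Y` for which
`f` is smooth, that is, the one generated by the maps `f ∘ q` with `q` a plot of `X`. -/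
@[reducible]
def coinduced {X Y : Type*} [DiffeologicalSpace X] (f : X → Y) : DiffeologicalSpace Y :=
  generateFrom {p | ∃ (n : ℕ) (q : EuclideanSpace ℝ (Fin n) → X), IsPlot q ∧ p = ⟨n, f ∘ q⟩}

/-- The subspace diffeology. -/
instance instSubtypeDiffeology {X : Type*} [DiffeologicalSpace X] (p : X → Prop) :
    DiffeologicalSpace {x // p x} :=
  induced Subtype.val

/-- The product diffeology on a binary product. -/
instance instProdDiffeology {X Y : Type*} [DiffeologicalSpace X] [DiffeologicalSpace Y] :
    DiffeologicalSpace (X × Y) :=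
  induced Prod.fst ⊓ induced Prod.snd

/-- The product diffeology on an arbitrary product. -/
instance instPiDiffeology {ι : Type*} {X : ι → Type*} [∀ i, DiffeologicalSpace (X i)] :
    DiffeologicalSpace (∀ i, X i) :=
  ⨅ i, induced fun x : ∀ i, X i ↦ x i

end DiffeologicalSpace

namespace Diffeology

/-- A subduction is a quotient map of diffeological spaces: a surjection onto a space which carries
the quotient diffeology. -/
def IsSubduction {X Y : Type*} [DiffeologicalSpace X] [dY : DiffeologicalSpace Y]
    (f : X → Y) : Prop :=
  Function.Surjective f ∧ dY = DiffeologicalSpace.coinduced f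

/-! ### Diffeological vector spaces -/

/-- A diffeological vector space: a real vector space with a diffeology for which addition and
scalar multiplication are smooth. -/
class IsDiffVectorSpace (V : Type*) [AddCommGroup V] [Module ℝ V] [DiffeologicalSpace V] :
    Prop where
  dSmooth_add : DSmooth fun x : V × V ↦ x.1 + x.2
  dSmooth_smul : DSmooth fun x : ℝ × V ↦ x.1 • x.2

/-- A diffeological vector space `P` is projective if every smooth linear map `P → W` lifts along
every linear subduction `V → W` to a smooth linear map `P → V`. -/
def IsProjective.{u} (P : Type u) [AddCommGroup P] [Module ℝ P] [DiffeologicalSpace P] : Prop :=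
  ∀ (V W : Type u) [AddCommGroup V] [Module ℝ V] [DiffeologicalSpace V] [IsDiffVectorSpace V]
    [AddCommGroup W] [Module ℝ W] [DiffeologicalSpace W] [IsDiffVectorSpace W]
    (q : V →ₗ[ℝ] W) (f : P →ₗ[ℝ] W), IsSubduction q → DSmooth f →
      ∃ g : P →ₗ[ℝ] V, DSmooth g ∧ q ∘ₗ g = f

/-- The underlying vector space `⨁_{x ∈ X} ℝ` of the free diffeological vector space `F(X)`. -/
abbrev FreeDiffVect (X : Type*) := X →₀ ℝ

/-- The map `(ℝ × X)ᵏ → F(X)`, `(r₁, x₁, …, rₖ, xₖ) ↦ ∑ rᵢ [xᵢ]`. -/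
noncomputable def freeSum (X : Type*) (k : ℕ) (z : Fin k → ℝ × X) : FreeDiffVect X :=
  ∑ i, Finsupp.single (z i).2 (z i).1

/-- The diffeology of the free diffeological vector space `F(X)`: it is generated by the maps
`(ℝ × X)ᵏ → F(X)`, `(r₁, x₁, …, rₖ, xₖ) ↦ ∑ rᵢ [xᵢ]`, for `k ≥ 1`. -/
noncomputable instance instFreeDiffeology {X : Type*} [DiffeologicalSpace X] :
    DiffeologicalSpace (FreeDiffVect X) :=
  ⨆ k : {k : ℕ // 0 < k}, DiffeologicalSpace.coinduced (freeSum X k)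

/-- The diffeology of the direct sum `⨁ᵢ Vᵢ` of diffeological vector spaces: the one generated by
the canonical maps `∏_{j ∈ J} Vⱼ → ⨁ᵢ Vᵢ` for finite sets `J` of indices, so that the direct sum is
the colimit of the finite products. -/
noncomputable instance instDirectSumDiffeology {ι : Type*} {V : ι → Type*}
    [∀ i, AddCommGroup (V i)] [∀ i, DiffeologicalSpace (V i)] :
    DiffeologicalSpace (Π₀ i, V i) :=
  letI := Classical.decEq ι
  ⨆ J : Finset ι, DiffeologicalSpace.coinduced
    (DFinsupp.mk J : (∀ j : (↑J : Set ι), V j) → Π₀ i, V i)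

/-- `P` is (isomorphic to) a smooth direct summand of `V`: there is a linear subspace `Q` of `V`,
with the subspace diffeology, such that `V` is isomorphic to `P × Q` as a diffeological vector
space. -/
def IsSmoothDirectSummand (P V : Type*) [AddCommGroup P] [Module ℝ P] [DiffeologicalSpace P]
    [AddCommGroup V] [Module ℝ V] [DiffeologicalSpace V] : Prop :=
  ∃ (Q : Submodule ℝ V) (e : (P × Q) ≃ₗ[ℝ] V), DSmooth e ∧ DSmooth e.symm

/-- A countably-generated projective diffeological vector space: a projective diffeological vector
space which is a smooth direct summand of a countable direct sum of free diffeological vector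
spaces `F(Uᵢ)` with each `Uᵢ` an open subset of a Euclidean space. -/
structure IsCountablyGeneratedProjective (P : Type*) [AddCommGroup P] [Module ℝ P]
    [DiffeologicalSpace P] : Prop where
  projective : IsProjective P
  countablyGenerated : ∃ (ι : Type) (_ : Countable ι) (n : ι → ℕ)
    (U : ∀ i, TopologicalSpace.Opens (EuclideanSpace ℝ (Fin (n i)))),
    IsSmoothDirectSummand P (Π₀ i, FreeDiffVect (U i))

end Diffeology

/-! ### `k_ω`-spaces -/

/-- A `k_ω`-space: a Hausdorff space with a countable cover by compact sets `Kₙ` such that a set `F`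
is closed if and only if `F ∩ Kₙ` is closed in `Kₙ` for every `n`. -/
def IsKOmegaSpace (X : Type*) [TopologicalSpace X] : Prop :=
  T2Space X ∧ ∃ K : ℕ → Set X, (∀ n, IsCompact (K n)) ∧ (⋃ n, K n) = Set.univ ∧
    ∀ F : Set X, IsClosed F ↔ ∀ n, IsClosed ((↑) ⁻¹' F : Set (K n))

/-! ### Spaces exhausted by compact sets -/

section Exhaustion

open Set Filter Topology

/-! Everything follows from one property, `IsCountablyPlotGenerated`. It holds for Euclidean spaces
and their open subsets, and it passes to finite products, to Hausdorff countable colimits and to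
smooth retracts. It therefore reaches `F(U)`, countable direct sums of such spaces, and finally `P`.
Finite unions of images of closed balls under the generating plots give compact sets that determine
the topology, which is the `k_ω` property. The main difficulty is that the D-topology of a product
could be strictly finer than the product topology. Given `O` open along all `pᵢ × qⱼ`, compact boxes
inside `O` are enlarged step by step along the exhaustions (`exists_box_mem_nhdsWithin`). The two
unions of sides are open, so `O` contains a product neighbourhood of each of its points. Smooth
addition and scalar multiplication are then jointly continuous. -/

/-- The compact sets `⋃_{c i ≤ n} pᵢ(B̄(0, n))` attached to a family of maps `pᵢ` out of Euclidean
spaces whose indices are numbered by `c`. -/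
def ballExhaustion {X κ : Type*} {d : κ → ℕ} (c : κ → ℕ)
    (p : ∀ i, EuclideanSpace ℝ (Fin (d i)) → X) (n : ℕ) : Set X :=
  ⋃ i ∈ c ⁻¹' Iic n, p i '' Metric.closedBall 0 n

variable {X Y κ l : Type*} {d : κ → ℕ} {e : l → ℕ} {c : κ → ℕ} {c' : l → ℕ}
  {p : ∀ i, EuclideanSpace ℝ (Fin (d i)) → X} {q : ∀ i, EuclideanSpace ℝ (Fin (e i)) → Y}

theorem monotone_ballExhaustion : Monotone (ballExhaustion c p) := fun m n hmn ↦ by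
  refine iUnion_mono fun i ↦ iUnion_mono' fun hi ↦ ⟨le_trans hi hmn, image_mono ?_⟩
  exact Metric.closedBall_subset_closedBall (by exact_mod_cast hmn)

theorem isCompact_ballExhaustion [TopologicalSpace X] (hc : Function.Injective c)
    (hp : ∀ i, Continuous (p i)) (n : ℕ) : IsCompact (ballExhaustion c p n) :=
  ((finite_Iic n).preimage hc.injOn).isCompact_biUnion fun i _ ↦
    (isCompact_closedBall _ _).image (hp i)

theorem exists_preimage_ballExhaustion_mem_nhds (i : κ) (z : EuclideanSpace ℝ (Fin (d i))) :
    ∃ n, p i ⁻¹' ballExhaustion c p n ∈ 𝓝 z := by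
  obtain ⟨m, hm⟩ := exists_nat_gt ‖z‖
  refine ⟨max m (c i), mem_of_superset (Metric.isOpen_ball.mem_nhds (x := z)
    (s := Metric.ball 0 m) (by simpa using hm)) fun w hw ↦ ?_⟩
  refine mem_iUnion₂.2 ⟨i, (le_max_right _ _ : c i ≤ max m (c i)), w, ?_, rfl⟩
  have : ‖w‖ < m := by simpa using hw
  simpa using Or.inl this.le

theorem iUnion_ballExhaustion (hs : ∀ x, ∃ i z, p i z = x) :
    ⋃ n, ballExhaustion c p n = univ := by
  refine eq_univ_of_forall fun x ↦ ?_
  obtain ⟨i, z, rfl⟩ := hs x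
  obtain ⟨n, hn⟩ := exists_preimage_ballExhaustion_mem_nhds (c := c) (p := p) i z
  exact mem_iUnion.2 ⟨n, mem_preimage.1 (mem_of_mem_nhds hn)⟩

/-- Near `z` the map `p i` is continuous with values in a single compact set of the exhaustion, so
relative neighbourhoods pull back to neighbourhoods of `z`. Asking only for large `n` matches what
the union of growing boxes provides. -/
theorem isOpen_of_forall_mem_nhdsWithin_ballExhaustion [TopologicalSpace X]
    (hp : ∀ i, Continuous (p i)) (ho : ∀ O, (∀ i, IsOpen (p i ⁻¹' O)) → IsOpen O) {O : Set X}
    (h : ∀ x ∈ O, ∃ N, ∀ n ≥ N, O ∈ 𝓝[ballExhaustion c p n] x) : IsOpen O := by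
  refine ho O fun i ↦ isOpen_iff_mem_nhds.2 fun z hz ↦ ?_
  obtain ⟨m, hm⟩ := exists_preimage_ballExhaustion_mem_nhds (c := c) (p := p) i z
  obtain ⟨N, hN⟩ := h _ hz
  have h1 : ballExhaustion c p (max m N) ∈ map (p i) (𝓝 z) :=
    mem_of_superset hm (preimage_mono (monotone_ballExhaustion (le_max_left m N)))
  exact le_inf (hp i).continuousAt (le_principal_iff.2 h1) (hN _ (le_max_right m N))

/-- A compact box inside `O` can be enlarged, relative to the compact box `K × L`, to a compact box
inside `O`. -/
theorem exists_isCompact_box_enlargement [TopologicalSpace X] [TopologicalSpace Y] [T2Space X]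
    [T2Space Y] {K A : Set X} {L B : Set Y} {O : Set (X × Y)} (hK : IsCompact K) (hL : IsCompact L)
    (hO : IsClosed ((K ×ˢ L) \ O)) (hA : IsCompact A) (hB : IsCompact B)
    (hAB : A ×ˢ B ⊆ O) :
    ∃ (A' : Set X) (B' : Set Y), IsCompact A' ∧ IsCompact B' ∧ A' ⊆ K ∧ B' ⊆ L ∧ A' ×ˢ B' ⊆ O ∧
      (∃ w, IsOpen w ∧ A ⊆ w ∧ w ∩ K ⊆ A') ∧ ∃ w, IsOpen w ∧ B ⊆ w ∧ w ∩ L ⊆ B' := by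
  -- `O` is not known to be open, so the tube avoids the closed set `(K ×ˢ L) \ O` instead of lying
  -- in `O`.
  obtain ⟨u, v, hu, hv, hAu, hBv, huv⟩ := generalized_tube_lemma hA hB hO.isOpen_compl
    (fun z hz hz' ↦ hz'.2 (hAB hz))
  -- Since `K \ u ⊆ w₂`, the compact set `K \ w₂` lies in `u`; it contains the relative
  -- neighbourhood `w₁ ∩ K` of `A`.
  obtain ⟨w₁, w₂, hw₁, hw₂, hAw, hKw, hw⟩ := SeparatedNhds.of_isCompact_isCompact hA (hK.diff hu)
    (disjoint_left.2 fun x hx hx' ↦ hx'.2 (hAu hx))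
  obtain ⟨t₁, t₂, ht₁, ht₂, hBt, hLt, ht⟩ := SeparatedNhds.of_isCompact_isCompact hB (hL.diff hv)
    (disjoint_left.2 fun x hx hx' ↦ hx'.2 (hBv hx))
  refine ⟨K \ w₂, L \ t₂, hK.diff hw₂, hL.diff ht₂, sdiff_subset, sdiff_subset, ?_,
    ⟨w₁, hw₁, hAw, fun x hx ↦ ⟨hx.2, disjoint_left.1 hw hx.1⟩⟩,
    ⟨t₁, ht₁, hBt, fun x hx ↦ ⟨hx.2, disjoint_left.1 ht hx.1⟩⟩⟩
  rintro ⟨x, y⟩ ⟨⟨hx, hx'⟩, hy, hy'⟩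
  have hxu : x ∈ u := by_contra fun h ↦ hx' (hKw ⟨hx, h⟩)
  have hyv : y ∈ v := by_contra fun h ↦ hy' (hLt ⟨hy, h⟩)
  exact by_contra fun h ↦ huv (mk_mem_prod hxu hyv) ⟨⟨hx, hy⟩, h⟩

/-- A set `O ⊆ X × Y` whose trace on every product `Kₙ × Lₙ` of compact sets is relatively open
contains a box around each of its points that is relatively open on every `Kₙ` and `Lₙ`. -/
theorem exists_box_mem_nhdsWithin [TopologicalSpace X] [TopologicalSpace Y] [T2Space X]
    [T2Space Y] {K : ℕ → Set X} {L : ℕ → Set Y} {O : Set (X × Y)} (hK : ∀ n, IsCompact (K n))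
    (hL : ∀ n, IsCompact (L n)) (hKm : Monotone K) (hLm : Monotone L)
    (hO : ∀ n, IsClosed ((K n ×ˢ L n) \ O)) {x : X} {y : Y} (hx : x ∈ K 0) (hy : y ∈ L 0)
    (hxy : (x, y) ∈ O) :
    ∃ (U : Set X) (V : Set Y), x ∈ U ∧ y ∈ V ∧ U ×ˢ V ⊆ O ∧
      (∀ z ∈ U, ∃ N, ∀ n ≥ N, U ∈ 𝓝[K n] z) ∧ ∀ z ∈ V, ∃ N, ∀ n ≥ N, V ∈ 𝓝[L n] z := by
  let S (n : ℕ) := {C : Set X × Set Y // IsCompact C.1 ∧ IsCompact C.2 ∧ C.1 ⊆ K n ∧ C.2 ⊆ L n ∧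
    C.1 ×ˢ C.2 ⊆ O}
  have step (n : ℕ) (C : S n) : ∃ C' : S (n + 1),
      (∃ w, IsOpen w ∧ C.1.1 ⊆ w ∧ w ∩ K (n + 1) ⊆ C'.1.1) ∧
      ∃ w, IsOpen w ∧ C.1.2 ⊆ w ∧ w ∩ L (n + 1) ⊆ C'.1.2 := by
    obtain ⟨⟨A, B⟩, hA, hB, hAK, hBL, hAB⟩ := C
    obtain ⟨A', B', h1, h2, h3, h4, h5, h6, h7⟩ := exists_isCompact_box_enlargement (hK (n + 1))
      (hL (n + 1)) (hO (n + 1)) hA hB hAB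
    exact ⟨⟨(A', B'), h1, h2, h3, h4, h5⟩, h6, h7⟩
  choose next hnext₁ hnext₂ using step
  let C (n : ℕ) : S n := Nat.rec ⟨({x}, {y}), isCompact_singleton, isCompact_singleton,
    by simpa, by simpa, by simpa⟩ next n
  have hC₁ (n : ℕ) : ∃ w, IsOpen w ∧ (C n).1.1 ⊆ w ∧ w ∩ K (n + 1) ⊆ (C (n + 1)).1.1 :=
    hnext₁ n (C n)
  have hC₂ (n : ℕ) : ∃ w, IsOpen w ∧ (C n).1.2 ⊆ w ∧ w ∩ L (n + 1) ⊆ (C (n + 1)).1.2 :=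
    hnext₂ n (C n)
  have mono₁ : Monotone fun n ↦ (C n).1.1 := monotone_nat_of_le_succ fun n ↦ by
    obtain ⟨w, -, h1, h2⟩ := hC₁ n
    exact fun z hz ↦ h2 ⟨h1 hz, hKm n.le_succ ((C n).2.2.2.1 hz)⟩
  have mono₂ : Monotone fun n ↦ (C n).1.2 := monotone_nat_of_le_succ fun n ↦ by
    obtain ⟨w, -, h1, h2⟩ := hC₂ n
    exact fun z hz ↦ h2 ⟨h1 hz, hLm n.le_succ ((C n).2.2.2.2.1 hz)⟩
  refine ⟨⋃ n, (C n).1.1, ⋃ n, (C n).1.2, mem_iUnion.2 ⟨0, rfl⟩, mem_iUnion.2 ⟨0, rfl⟩, ?_, ?_, ?_⟩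
  · rintro ⟨a, b⟩ ⟨ha, hb⟩
    obtain ⟨m, hm⟩ := mem_iUnion.1 ha
    obtain ⟨n, hn⟩ := mem_iUnion.1 hb
    exact (C (max m n)).2.2.2.2.2
      ⟨mono₁ (le_max_left m n) hm, mono₂ (le_max_right m n) hn⟩
  · intro z hz
    obtain ⟨N, hN⟩ := mem_iUnion.1 hz
    refine ⟨N, fun n hn ↦ ?_⟩
    -- The open set `w` from stage `n` is controlled on `K (n + 1)`, hence on the smaller `K n`.
    obtain ⟨w, hw, h1, h2⟩ := hC₁ n
    exact mem_nhdsWithin.2 ⟨w, hw, h1 (mono₁ hn hN), fun a ha ↦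
      mem_iUnion.2 ⟨n + 1, h2 ⟨ha.1, hKm n.le_succ ha.2⟩⟩⟩
  · intro z hz
    obtain ⟨N, hN⟩ := mem_iUnion.1 hz
    refine ⟨N, fun n hn ↦ ?_⟩
    obtain ⟨w, hw, h1, h2⟩ := hC₂ n
    exact mem_nhdsWithin.2 ⟨w, hw, h1 (mono₂ hn hN), fun a ha ↦
      mem_iUnion.2 ⟨n + 1, h2 ⟨ha.1, hLm n.le_succ ha.2⟩⟩⟩

/-- The set is a finite union of images of compact sets, namely products of closed balls minus the
open preimages of `O`. It is thus compact, and closed because `X × Y` is Hausdorff. -/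
theorem isClosed_prod_ballExhaustion_diff [TopologicalSpace X] [TopologicalSpace Y] [T2Space X]
    [T2Space Y] (hc : Function.Injective c) (hc' : Function.Injective c')
    (hp : ∀ i, Continuous (p i)) (hq : ∀ j, Continuous (q j)) {O : Set (X × Y)}
    (hO : ∀ i j, IsOpen (Prod.map (p i) (q j) ⁻¹' O)) (m n : ℕ) :
    IsClosed ((ballExhaustion c p m ×ˢ ballExhaustion c' q n) \ O) := by
  have key : (ballExhaustion c p m ×ˢ ballExhaustion c' q n) \ O =
      ⋃ i ∈ c ⁻¹' Iic m, ⋃ j ∈ c' ⁻¹' Iic n, Prod.map (p i) (q j) ''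
        ((Metric.closedBall 0 m ×ˢ Metric.closedBall 0 n) \ (Prod.map (p i) (q j) ⁻¹' O)) := by
    ext ⟨x, y⟩
    simp only [ballExhaustion, Set.mem_sdiff, mem_prod, mem_iUnion, mem_image, exists_prop]
    constructor
    · rintro ⟨⟨⟨i, hi, a, ha, rfl⟩, j, hj, b, hb, rfl⟩, h⟩
      exact ⟨i, hi, j, hj, (a, b), ⟨⟨ha, hb⟩, h⟩, rfl⟩
    · rintro ⟨i, hi, j, hj, ⟨a, b⟩, ⟨⟨ha, hb⟩, h⟩, hab⟩
      obtain ⟨rfl, rfl⟩ := Prod.ext_iff.1 hab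
      exact ⟨⟨⟨i, hi, a, ha, rfl⟩, j, hj, b, hb, rfl⟩, h⟩
  rw [key]
  refine IsCompact.isClosed (((finite_Iic m).preimage hc.injOn).isCompact_biUnion fun i _ ↦
    ((finite_Iic n).preimage hc'.injOn).isCompact_biUnion fun j _ ↦ ?_)
  exact (((isCompact_closedBall _ _).prod (isCompact_closedBall _ _)).diff (hO i j)).image
    ((hp i).prodMap (hq j))

/-- If countable families of maps `pᵢ` and `qⱼ` out of Euclidean spaces determine the Hausdorff
topologies of `X` and `Y`, then the maps `pᵢ × qⱼ` determine the product topology. -/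
theorem isOpen_prod_of_forall_isOpen_preimage [TopologicalSpace X] [TopologicalSpace Y] [T2Space X]
    [T2Space Y] [Countable κ] [Countable l] (hp : ∀ i, Continuous (p i))
    (hq : ∀ j, Continuous (q j)) (hps : ∀ x, ∃ i z, p i z = x) (hqs : ∀ y, ∃ j z, q j z = y)
    (hpo : ∀ O, (∀ i, IsOpen (p i ⁻¹' O)) → IsOpen O)
    (hqo : ∀ O, (∀ j, IsOpen (q j ⁻¹' O)) → IsOpen O) {O : Set (X × Y)}
    (hO : ∀ i j, IsOpen (Prod.map (p i) (q j) ⁻¹' O)) : IsOpen O := by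
  obtain ⟨c, hc⟩ := exists_injective_nat κ
  obtain ⟨c', hc'⟩ := exists_injective_nat l
  refine isOpen_prod_iff.2 fun x y hxy ↦ ?_
  obtain ⟨m, hm⟩ := mem_iUnion.1 ((iUnion_ballExhaustion (c := c) hps).ge (mem_univ x))
  obtain ⟨n, hn⟩ := mem_iUnion.1 ((iUnion_ballExhaustion (c := c') hqs).ge (mem_univ y))
  -- The exhaustions are shifted by `m` and `n` so that `x` and `y` already lie in their initial
  -- sets.
  obtain ⟨U, V, hxU, hyV, hUV, hU, hV⟩ := exists_box_mem_nhdsWithin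
    (K := fun k ↦ ballExhaustion c p (k + m)) (L := fun k ↦ ballExhaustion c' q (k + n))
    (fun _ ↦ isCompact_ballExhaustion hc hp _) (fun _ ↦ isCompact_ballExhaustion hc' hq _)
    (fun _ _ h ↦ monotone_ballExhaustion (by lia)) (fun _ _ h ↦ monotone_ballExhaustion (by lia))
    (fun _ ↦ isClosed_prod_ballExhaustion_diff hc hc' hp hq hO _ _) (by simpa) (by simpa) hxy
  refine ⟨U, V, isOpen_of_forall_mem_nhdsWithin_ballExhaustion (c := c) hp hpo fun z hz ↦ ?_,
    isOpen_of_forall_mem_nhdsWithin_ballExhaustion (c := c') hq hqo fun z hz ↦ ?_, hxU, hyV, hUV⟩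
  · obtain ⟨N, hN⟩ := hU z hz
    exact ⟨N + m, fun k hk ↦ by simpa [show k - m + m = k by lia] using hN (k - m) (by lia)⟩
  · obtain ⟨N, hN⟩ := hV z hz
    exact ⟨N + n, fun k hk ↦ by simpa [show k - n + n = k by lia] using hN (k - n) (by lia)⟩

theorem isKOmegaSpace_of_forall_isOpen_preimage [TopologicalSpace X] [T2Space X] [Countable κ]
    (hp : ∀ i, Continuous (p i)) (hps : ∀ x, ∃ i z, p i z = x)
    (hpo : ∀ O, (∀ i, IsOpen (p i ⁻¹' O)) → IsOpen O) : IsKOmegaSpace X := by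
  obtain ⟨c, hc⟩ := exists_injective_nat κ
  refine ⟨‹_›, ballExhaustion c p, isCompact_ballExhaustion hc hp, iUnion_ballExhaustion hps,
    fun F ↦ ⟨fun hF n ↦ hF.preimage continuous_subtype_val, fun hF ↦ ?_⟩⟩
  rw [← isOpen_compl_iff]
  refine isOpen_of_forall_mem_nhdsWithin_ballExhaustion (c := c) hp hpo fun x hx ↦
    ⟨0, fun n _ ↦ ?_⟩
  have h := (isCompact_ballExhaustion hc hp n).isClosed.isClosedEmbedding_subtypeVal
    |>.isClosed_iff_image_isClosed.1 (hF n)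
  rw [Subtype.image_preimage_coe] at h
  exact mem_nhdsWithin.2 ⟨_, h.isOpen_compl, fun h' ↦ hx h'.2, fun z hz hz' ↦ hz.1 ⟨hz.2, hz'⟩⟩

end Exhaustion

section CountablyPlotGenerated

open Topology

/-! ### The D-topology of generated diffeologies -/

namespace DiffeologicalSpace

/-- The diffeology whose plots are the continuous maps. -/
@[reducible]
def ofTopology {X : Type*} (τ : TopologicalSpace X) : DiffeologicalSpace X :=
  .ofCorePlotsOn {
    isPlotOn := fun {_ u} _ p ↦ ContinuousOn p u
    isPlotOn_congr := fun _ _ _ h ↦ continuousOn_congr h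
    isPlot_const := fun _ ↦ continuousOn_const
    isPlotOn_reparam := fun _ _ _ h hp hf ↦ hp.comp hf.continuousOn h
    locality := fun _ _ h x hx ↦
      let ⟨_, hv, hxv, hp⟩ := h x hx
      (hp.continuousAt (hv.mem_nhds hxv)).continuousWithinAt }

theorem isPlot_ofTopology_iff {X : Type*} {τ : TopologicalSpace X} {n : ℕ}
    {p : EuclideanSpace ℝ (Fin n) → X} : @IsPlot X (ofTopology τ) n p ↔ Continuous p :=
  continuousOn_univ

theorem isPlot_coinduced {X Y : Type*} [DiffeologicalSpace X] (f : X → Y) {n : ℕ}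
    {p : EuclideanSpace ℝ (Fin n) → X} (hp : IsPlot p) : @IsPlot Y (coinduced f) n (f ∘ p) :=
  isPlot_generatedFrom_of_mem ⟨n, p, hp, rfl⟩

theorem isPlot_iSup_coinduced {κ Y : Type*} {X : κ → Type*} [∀ k, DiffeologicalSpace (X k)]
    (f : ∀ k, X k → Y) (k : κ) {n : ℕ} {p : EuclideanSpace ℝ (Fin n) → X k} (hp : IsPlot p) :
    @IsPlot Y (⨆ k, coinduced (f k)) n (f k ∘ p) :=
  le_iff'.1 (le_iSup (fun k ↦ coinduced (f k)) k) _ _ (isPlot_coinduced (f k) hp)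

/-- The D-topology commutes with colimits. For the converse direction, the maps continuous for the
colimit topology `τ` form a diffeology containing all generators `f k ∘ q`, so every plot is
`τ`-continuous. -/
theorem isOpen_dTopology_iSup_coinduced {κ Y : Type*} {X : κ → Type*}
    [∀ k, DiffeologicalSpace (X k)] (f : ∀ k, X k → Y) {O : Set Y} :
    IsOpen[(⨆ k, coinduced (f k)).dTopology] O ↔ ∀ k, IsOpen[dTopology] (f k ⁻¹' O) := by
  constructor
  · intro h k
    exact Diffeology.isOpen_iff_preimages_plots.2 fun n p hp ↦
      (@Diffeology.isOpen_iff_preimages_plots Y (⨆ k, coinduced (f k)) O).1 h n (f k ∘ p)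
        (isPlot_iSup_coinduced f k hp)
  · intro h
    let τ : TopologicalSpace Y := ⨆ k, TopologicalSpace.coinduced (f k) dTopology
    have hle : ⨆ k, coinduced (f k) ≤ ofTopology τ := iSup_le fun k ↦ by
      refine generateFrom_le_iff.2 ?_
      rintro n p ⟨m, q, hq, h⟩
      obtain ⟨rfl, h⟩ := Sigma.mk.inj h
      obtain rfl := eq_of_heq h
      refine isPlot_ofTopology_iff.2 (continuous_def.2 fun U hU ↦ ?_)
      exact Diffeology.isOpen_iff_preimages_plots.1 (isOpen_iSup_iff.1 hU k) _ q hq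
    refine (@Diffeology.isOpen_iff_preimages_plots Y (⨆ k, coinduced (f k)) O).2 fun n p hp ↦ ?_
    have hO : IsOpen[τ] O := isOpen_iSup_iff.2 h
    exact (isPlot_ofTopology_iff.1 (le_iff'.1 hle n p hp)).isOpen_preimage O hO

theorem continuous_dTopology_iSup_coinduced {κ Y Z : Type*} {X : κ → Type*}
    [∀ k, DiffeologicalSpace (X k)] [TopologicalSpace Z] (f : ∀ k, X k → Y) {g : Y → Z}
    (h : ∀ k, Continuous[dTopology, _] (g ∘ f k)) :
    Continuous[(⨆ k, coinduced (f k)).dTopology, _] g := by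
  refine continuous_def.2 fun O hO ↦ (isOpen_dTopology_iSup_coinduced f).2 fun k ↦ ?_
  exact continuous_def.1 (h k) O hO

end DiffeologicalSpace

namespace Diffeology

/-! ### Plots of products and smooth structural maps -/

theorem isPlot_prod_iff {X Y : Type*} [DiffeologicalSpace X] [DiffeologicalSpace Y] {n : ℕ}
    {p : EuclideanSpace ℝ (Fin n) → X × Y} :
    IsPlot p ↔ IsPlot (fun z ↦ (p z).1) ∧ IsPlot fun z ↦ (p z).2 :=
  DiffeologicalSpace.isPlot_inf_iff

theorem isPlot_pi_iff {ι : Type*} {X : ι → Type*} [∀ i, DiffeologicalSpace (X i)] {n : ℕ}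
    {p : EuclideanSpace ℝ (Fin n) → ∀ i, X i} : IsPlot p ↔ ∀ i, IsPlot fun z ↦ p z i :=
  DiffeologicalSpace.isPlot_iInf_iff

theorem dSmooth_fst {X Y : Type*} [DiffeologicalSpace X] [DiffeologicalSpace Y] :
    DSmooth (Prod.fst : X × Y → X) := fun _ _ hp ↦ (isPlot_prod_iff.1 hp).1

theorem dSmooth_snd {X Y : Type*} [DiffeologicalSpace X] [DiffeologicalSpace Y] :
    DSmooth (Prod.snd : X × Y → Y) := fun _ _ hp ↦ (isPlot_prod_iff.1 hp).2

theorem dSmooth_eval {ι : Type*} {X : ι → Type*} [∀ i, DiffeologicalSpace (X i)] (i : ι) :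
    DSmooth fun x : ∀ i, X i ↦ x i := fun _ _ hp ↦ isPlot_pi_iff.1 hp i

theorem dSmooth_subtype_val {X : Type*} [DiffeologicalSpace X] {s : X → Prop} :
    DSmooth (Subtype.val : {x // s x} → X) := fun _ _ hp ↦ hp

/-! ### Diffeological spaces generated by countably many plots -/

/-- The D-topology of `X` is Hausdorff, and it is determined by a countable jointly surjective
family of plots. -/
def IsCountablyPlotGenerated (X : Type*) [DiffeologicalSpace X] : Prop :=
  @T2Space X dTopology ∧ ∃ (κ : Type) (_ : Countable κ) (d : κ → ℕ)
    (p : ∀ i, EuclideanSpace ℝ (Fin (d i)) → X), (∀ i, IsPlot (p i)) ∧ (∀ x, ∃ i z, p i z = x) ∧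
      ∀ O : Set X, (∀ i, IsOpen (p i ⁻¹' O)) → IsOpen[dTopology] O

theorem dTopology_le_instTopologicalSpaceProd {X Y : Type*} [DiffeologicalSpace X]
    [DiffeologicalSpace Y] :
    (dTopology : TopologicalSpace (X × Y)) ≤ @instTopologicalSpaceProd X Y dTopology dTopology :=
  le_inf (continuous_iff_le_induced.1 dSmooth_fst.continuous)
    (continuous_iff_le_induced.1 dSmooth_snd.continuous)

namespace IsCountablyPlotGenerated

variable {X Y : Type*} [DiffeologicalSpace X] [DiffeologicalSpace Y]

theorem isKOmegaSpace (hX : IsCountablyPlotGenerated X) : @IsKOmegaSpace X dTopology := by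
  let _ : TopologicalSpace X := dTopology
  obtain ⟨hT, κ, _, d, p, hp, hps, hpo⟩ := hX
  exact isKOmegaSpace_of_forall_isOpen_preimage (fun i ↦ (hp i).continuous) hps hpo

/-- The continuous linear equivalence between `ℝⁿ⁺ᵐ` and `ℝⁿ × ℝᵐ`. -/
noncomputable def euclideanProdEquiv (n m : ℕ) : EuclideanSpace ℝ (Fin (n + m)) ≃L[ℝ]
    EuclideanSpace ℝ (Fin n) × EuclideanSpace ℝ (Fin m) :=
  ContinuousLinearEquiv.ofFinrankEq (by simp)

theorem isPlot_prodMap {n m : ℕ} {p : EuclideanSpace ℝ (Fin n) → X}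
    {q : EuclideanSpace ℝ (Fin m) → Y} (hp : IsPlot p) (hq : IsPlot q) :
    IsPlot (Prod.map p q ∘ euclideanProdEquiv n m) :=
  isPlot_prod_iff.2 ⟨isPlot_reparam hp (f := fun z ↦ (euclideanProdEquiv n m z).1)
      (contDiff_fst.comp (euclideanProdEquiv n m).contDiff),
    isPlot_reparam hq (f := fun z ↦ (euclideanProdEquiv n m z).2)
      (contDiff_snd.comp (euclideanProdEquiv n m).contDiff)⟩

/-- Openness is obtained in the product topology, a priori coarser than the D-topology. This gives
both the equality of the two and the stability of the property under products. -/
theorem isOpen_prod (hX : IsCountablyPlotGenerated X) (hY : IsCountablyPlotGenerated Y) :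
    ∃ (κ : Type) (_ : Countable κ) (d : κ → ℕ) (p : ∀ i, EuclideanSpace ℝ (Fin (d i)) → X × Y),
      (∀ i, IsPlot (p i)) ∧ (∀ x, ∃ i z, p i z = x) ∧ ∀ O : Set (X × Y),
        (∀ i, IsOpen (p i ⁻¹' O)) →
          IsOpen[@instTopologicalSpaceProd X Y dTopology dTopology] O := by
  let _ : TopologicalSpace X := dTopology
  let _ : TopologicalSpace Y := dTopology
  obtain ⟨hT, κ, _, d, p, hp, hps, hpo⟩ := hX
  obtain ⟨hT', l, _, e, q, hq, hqs, hqo⟩ := hY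
  refine ⟨κ × l, inferInstance, fun i ↦ d i.1 + e i.2,
    fun i ↦ Prod.map (p i.1) (q i.2) ∘ euclideanProdEquiv _ _,
    fun i ↦ isPlot_prodMap (hp i.1) (hq i.2), fun ⟨x, y⟩ ↦ ?_, fun O hO ↦ ?_⟩
  · obtain ⟨i, z, rfl⟩ := hps x
    obtain ⟨j, w, rfl⟩ := hqs y
    exact ⟨(i, j), (euclideanProdEquiv _ _).symm (z, w), by simp⟩
  · refine isOpen_prod_of_forall_isOpen_preimage (fun i ↦ (hp i).continuous)
      (fun j ↦ (hq j).continuous) hps hqs hpo hqo fun i j ↦ ?_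
    have h := hO (i, j)
    rw [Set.preimage_comp] at h
    exact (euclideanProdEquiv _ _).toHomeomorph.isOpen_preimage.1 h

/-- The D-topology of a product of two countably plot-generated spaces is the product topology. -/
theorem dTopology_prod (hX : IsCountablyPlotGenerated X) (hY : IsCountablyPlotGenerated Y) :
    (dTopology : TopologicalSpace (X × Y)) = @instTopologicalSpaceProd X Y dTopology dTopology := by
  refine le_antisymm dTopology_le_instTopologicalSpaceProd fun O hO ↦ ?_
  obtain ⟨κ, _, d, p, hp, -, hpo⟩ := hX.isOpen_prod hY
  exact hpo O fun i ↦ isOpen_iff_preimages_plots.1 hO _ _ (hp i)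

theorem prod (hX : IsCountablyPlotGenerated X) (hY : IsCountablyPlotGenerated Y) :
    IsCountablyPlotGenerated (X × Y) := by
  refine ⟨?_, ?_⟩
  · rw [hX.dTopology_prod hY]
    exact @Prod.t2Space X Y dTopology hX.1 dTopology hY.1
  · rw [hX.dTopology_prod hY]
    exact hX.isOpen_prod hY

/-! ### Retracts, finite products, open subsets and colimits -/

/-- A smooth retract of a countably plot-generated space is countably plot-generated. -/
theorem of_retract (hX : IsCountablyPlotGenerated X) {r : X → Y} {s : Y → X} (hr : DSmooth r)
    (hs : DSmooth s) (hrs : Function.LeftInverse r s) : IsCountablyPlotGenerated Y := by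
  obtain ⟨hT, κ, hκ, d, p, hp, hps, hpo⟩ := hX
  refine ⟨?_, κ, hκ, d, fun i ↦ r ∘ p i, fun i ↦ (hp i).dSmooth_comp hr, fun y ↦ ?_, fun O hO ↦ ?_⟩
  · let _ : TopologicalSpace X := dTopology
    let _ : TopologicalSpace Y := dTopology
    exact T2Space.of_injective_continuous hrs.injective hs.continuous
  · obtain ⟨i, z, h⟩ := hps (s y)
    exact ⟨i, z, by simp [h, hrs y]⟩
  · have h : s ⁻¹' (r ⁻¹' O) = O := by
      rw [← Set.preimage_comp, hrs.comp_eq_id, Set.preimage_id]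
    rw [← h]
    exact continuous_def.1 hs.continuous _ (hpo _ hO)

theorem of_subsingleton [Subsingleton X] [Nonempty X] : IsCountablyPlotGenerated X := by
  let _ : TopologicalSpace X := dTopology
  obtain ⟨x⟩ := ‹Nonempty X›
  exact ⟨inferInstance, Unit, inferInstance, fun _ ↦ 0, fun _ _ ↦ x, fun _ ↦ isPlot_const,
    fun y ↦ ⟨(), 0, Subsingleton.elim _ _⟩, fun O _ ↦ isOpen_discrete O⟩

theorem euclideanSpace (n : ℕ) : IsCountablyPlotGenerated (EuclideanSpace ℝ (Fin n)) :=
  ⟨inferInstanceAs (T2Space (EuclideanSpace ℝ (Fin n))), Unit, inferInstance, fun _ ↦ n,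
    fun _ ↦ id, fun _ ↦ isPlot_id, fun x ↦ ⟨(), x, rfl⟩, fun _ h ↦ h ()⟩

theorem real : IsCountablyPlotGenerated ℝ :=
  let e : EuclideanSpace ℝ (Fin 1) ≃L[ℝ] ℝ := ContinuousLinearEquiv.ofFinrankEq (by simp)
  (euclideanSpace 1).of_retract e.contDiff.dSmooth e.symm.contDiff.dSmooth e.apply_symm_apply

theorem pi {ι : Type} [Finite ι] (X : ι → Type) [∀ i, DiffeologicalSpace (X i)]
    (hX : ∀ i, IsCountablyPlotGenerated (X i)) : IsCountablyPlotGenerated (∀ i, X i) := by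
  -- The induction changes the index type, so the family `X` must be generalized first.
  suffices h : ∀ (X : ι → Type) (_ : ∀ i, DiffeologicalSpace (X i)),
      (∀ i, IsCountablyPlotGenerated (X i)) → IsCountablyPlotGenerated (∀ i, X i) from h X _ hX
  refine Finite.induction_empty_option (P := fun ι ↦ ∀ (X : ι → Type)
    (_ : ∀ i, DiffeologicalSpace (X i)), (∀ i, IsCountablyPlotGenerated (X i)) →
      IsCountablyPlotGenerated (∀ i, X i)) ?_ ?_ ?_ ι
  · intro α β e h X _ hX
    refine (h (fun a ↦ X (e a)) inferInstance fun a ↦ hX (e a)).of_retract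
      (r := Equiv.piCongrLeft X e) (s := fun x a ↦ x (e a)) ?_ ?_ ?_
    · refine fun n p hp ↦ isPlot_pi_iff.2 fun b ↦ ?_
      obtain ⟨a, rfl⟩ := e.surjective b
      simpa using isPlot_pi_iff.1 hp a
    · exact fun n p hp ↦ isPlot_pi_iff.2 fun a ↦ isPlot_pi_iff.1 hp (e a)
    · exact (Equiv.piCongrLeft X e).apply_symm_apply
  · exact fun X _ _ ↦ of_subsingleton
  · intro α _ h X _ hX
    refine ((hX none).prod (h (fun a ↦ X (some a)) inferInstance fun a ↦ hX (some a))).of_retract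
      (r := fun y o ↦ Option.rec y.1 y.2 o) (s := fun x ↦ (x none, fun a ↦ x (some a))) ?_ ?_ ?_
    · refine fun n p hp ↦ isPlot_pi_iff.2 fun o ↦ ?_
      cases o with
      | none => exact (isPlot_prod_iff.1 hp).1
      | some a => exact isPlot_pi_iff.1 (isPlot_prod_iff.1 hp).2 a
    · exact fun n p hp ↦ isPlot_prod_iff.2 ⟨isPlot_pi_iff.1 hp none,
        isPlot_pi_iff.2 fun a ↦ isPlot_pi_iff.1 hp (some a)⟩
    · intro x
      funext o
      cases o <;> rfl

/-- The plots here have all of `ℝⁿ` as domain, so `U` is covered by countably many balls, each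
parametrized by `ℝⁿ` through `univBall`. -/
theorem opens {n : ℕ} (U : TopologicalSpace.Opens (EuclideanSpace ℝ (Fin n))) :
    IsCountablyPlotGenerated U := by
  choose ρ hρ hρU using fun x : U ↦ Metric.isOpen_iff.1 U.isOpen x.1 x.2
  let p (x : U) (z : EuclideanSpace ℝ (Fin n)) : U :=
    ⟨OpenPartialHomeomorph.univBall x.1 (ρ x) z, hρU x <| by
      rw [← OpenPartialHomeomorph.univBall_target _ (hρ x)]
      exact OpenPartialHomeomorph.map_source _ (by simp)⟩
  have hp (x : U) {y : U} (hy : y.1 ∈ Metric.ball x.1 (ρ x)) : ∃ z, p x z = y := by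
    rw [← OpenPartialHomeomorph.univBall_target _ (hρ x)] at hy
    exact ⟨_, Subtype.ext (OpenPartialHomeomorph.right_inv _ hy)⟩
  obtain ⟨s, hs, hsU⟩ := TopologicalSpace.countable_cover_nhds
    (f := fun x : U ↦ Subtype.val ⁻¹' Metric.ball x.1 (ρ x)) fun x ↦
      (Metric.isOpen_ball.preimage continuous_subtype_val).mem_nhds (Metric.mem_ball_self (hρ x))
  have hcov (y : U) : ∃ x : s, y.1 ∈ Metric.ball x.1.1 (ρ x) := by
    obtain ⟨x, hx, hy⟩ := Set.mem_iUnion₂.1 (hsU.ge (Set.mem_univ y))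
    exact ⟨⟨x, hx⟩, hy⟩
  have hval : Continuous[dTopology, _] (Subtype.val : U → EuclideanSpace ℝ (Fin n)) :=
    dSmooth_subtype_val.continuous
  refine ⟨?_, s, hs, fun _ ↦ n, fun x ↦ p x, fun x ↦ ?_, fun y ↦ ?_, fun O hO ↦ ?_⟩
  · let _ : TopologicalSpace U := dTopology
    exact T2Space.of_injective_continuous Subtype.val_injective hval
  · exact (OpenPartialHomeomorph.contDiff_univBall (c := x.1.1) (r := ρ x)).isPlot
  · exact ⟨_, hp _ (hcov y).choose_spec⟩
  -- Each `univBall` is an open map, so `O` is the trace on `U` of an open subset of `ℝⁿ`.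
  · have h (x : s) : IsOpen (OpenPartialHomeomorph.univBall x.1.1 (ρ x) '' (p x ⁻¹' O)) :=
      OpenPartialHomeomorph.isOpen_image_of_subset_source _ (hO x) (by simp)
    have key : O = Subtype.val ⁻¹'
        ⋃ x : s, OpenPartialHomeomorph.univBall x.1.1 (ρ x) '' (p x ⁻¹' O) := by
      ext y
      simp only [Set.mem_preimage, Set.mem_iUnion, Set.mem_image]
      constructor
      · intro hy
        obtain ⟨x, hx⟩ := hcov y
        obtain ⟨z, rfl⟩ := hp x hx
        exact ⟨x, z, hy, rfl⟩
      · rintro ⟨x, z, hz, h⟩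
        rwa [show y = p x z from Subtype.ext h.symm]
    rw [key]
    exact continuous_def.1 hval _ (isOpen_iUnion h)

/-- The generating families of the pieces are composed with the `f k`. A colimit need not be
Hausdorff, so `hT` is supplied separately. -/
theorem iSup_coinduced {κ : Type} [Countable κ] {Z : κ → Type} [∀ k, DiffeologicalSpace (Z k)]
    {Y : Type*} (f : ∀ k, Z k → Y) (hZ : ∀ k, IsCountablyPlotGenerated (Z k))
    (hT : @T2Space Y (⨆ k, DiffeologicalSpace.coinduced (f k)).dTopology)
    (hf : ∀ y, ∃ k z, f k z = y) :
    @IsCountablyPlotGenerated Y (⨆ k, DiffeologicalSpace.coinduced (f k)) := by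
  choose _ l hl d p hp hps hpo using hZ
  refine ⟨hT, Σ k, l k, inferInstance, fun i ↦ d i.1 i.2, fun i ↦ f i.1 ∘ p i.1 i.2,
    fun i ↦ DiffeologicalSpace.isPlot_iSup_coinduced f i.1 (hp i.1 i.2), fun y ↦ ?_, fun O hO ↦ ?_⟩
  · obtain ⟨k, z, rfl⟩ := hf y
    obtain ⟨i, w, rfl⟩ := hps k z
    exact ⟨⟨k, i⟩, w, rfl⟩
  · exact (DiffeologicalSpace.isOpen_dTopology_iSup_coinduced f).2 fun k ↦
      hpo k _ fun i ↦ hO ⟨k, i⟩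

end IsCountablyPlotGenerated

end Diffeology

end CountablyPlotGenerated

section DirectSums

open Topology

/-! ### Free diffeological vector spaces and their direct sums -/

namespace Diffeology

theorem exists_freeSum_eq {X : Type*} [Nonempty X] (v : FreeDiffVect X) :
    ∃ (k : {k : ℕ // 0 < k}) (z : Fin k → ℝ × X), freeSum X k z = v := by
  induction v using Finsupp.induction with
  -- As `k ≥ 1`, the zero vector is written `0[x]`, which requires a point of `X`.
  | zero => exact ⟨⟨1, one_pos⟩, fun _ ↦ (0, Classical.arbitrary X), by simp [freeSum]⟩
  | single_add x r v _ _ ih =>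
    obtain ⟨⟨k, hk⟩, z, rfl⟩ := ih
    exact ⟨⟨k + 1, k.succ_pos⟩, Fin.cons (r, x) z, by simp [freeSum, Fin.sum_univ_succ]⟩

/-- A continuous function on `X` extends to a continuous linear functional on `F(X)`. -/
theorem continuous_linearCombination {X : Type*} [DiffeologicalSpace X] {φ : X → ℝ}
    (hφ : Continuous[dTopology, _] φ) :
    Continuous[dTopology, _] (Finsupp.linearCombination ℝ φ : FreeDiffVect X → ℝ) := by
  refine DiffeologicalSpace.continuous_dTopology_iSup_coinduced
    (fun k : {k : ℕ // 0 < k} ↦ freeSum X k) fun k ↦ ?_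
  let _ : TopologicalSpace X := dTopology
  let _ : TopologicalSpace (Fin k → ℝ × X) := dTopology
  have h : (Finsupp.linearCombination ℝ φ ∘ freeSum X k) =
      fun z ↦ ∑ i, (z i).1 * φ (z i).2 := by
    ext z
    simp [freeSum]
  rw [h]
  refine continuous_finsetSum _ fun i _ ↦ ?_
  have h1 : Continuous fun z : Fin k → ℝ × X ↦ (z i).1 :=
    (dSmooth_fst.comp (dSmooth_eval i)).continuous
  have h2 : Continuous fun z : Fin k → ℝ × X ↦ (z i).2 :=
    (dSmooth_snd.comp (dSmooth_eval i)).continuous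
  exact h1.mul (hφ.comp h2)

/-- Distinct vectors are separated by a continuous linear functional: extend a continuous `φ` that
vanishes on the support of `v - w` except at one point `x`. A product of distances to the other
support points is such a `φ`. -/
theorem t2Space_freeDiffVect {n : ℕ} (U : TopologicalSpace.Opens (EuclideanSpace ℝ (Fin n))) :
    @T2Space (FreeDiffVect U) dTopology := by
  let _ : TopologicalSpace (FreeDiffVect U) := dTopology
  refine ⟨fun v w hvw ↦ ?_⟩
  obtain ⟨x, hx⟩ := Finsupp.support_nonempty_iff.2 (sub_ne_zero.2 hvw)
  let φ (y : U) : ℝ := ∏ z ∈ (v - w).support.erase x, ‖(y : EuclideanSpace ℝ (Fin n)) - z‖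
  have hφ : Continuous[dTopology, _] φ := by
    let _ : TopologicalSpace U := dTopology
    have : Continuous (Subtype.val : U → EuclideanSpace ℝ (Fin n)) :=
      dSmooth_subtype_val.continuous
    exact continuous_finsetProd _ fun z _ ↦ (this.sub continuous_const).norm
  have h : Finsupp.linearCombination ℝ φ (v - w) = (v - w) x * φ x := by
    rw [Finsupp.linearCombination_apply, Finsupp.sum, Finset.sum_eq_single_of_mem x hx]
    · rfl
    · intro y hy hyx
      simp only [φ, smul_eq_mul]
      rw [Finset.prod_eq_zero (Finset.mem_erase.2 ⟨hyx, hy⟩) (by simp), mul_zero]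
  have h0 : (v - w) x * φ x ≠ 0 := by
    refine mul_ne_zero (Finsupp.mem_support_iff.1 hx) (Finset.prod_ne_zero_iff.2 fun z hz ↦ ?_)
    rw [norm_ne_zero_iff, sub_ne_zero]
    exact fun h ↦ (Finset.mem_erase.1 hz).1 (Subtype.ext h.symm)
  rw [← h, map_sub, sub_ne_zero] at h0
  exact separated_by_continuous (continuous_linearCombination hφ) h0

theorem IsCountablyPlotGenerated.freeDiffVect {n : ℕ}
    (U : TopologicalSpace.Opens (EuclideanSpace ℝ (Fin n))) :
    IsCountablyPlotGenerated (FreeDiffVect U) := by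
  -- For empty `U` the spaces `(ℝ × U)ᵏ` with `k ≥ 1` are empty and miss the zero vector.
  rcases isEmpty_or_nonempty U with hU | hU
  · exact of_subsingleton
  · exact iSup_coinduced (fun k : {k : ℕ // 0 < k} ↦ freeSum U k)
      (fun k ↦ pi _ fun _ ↦ real.prod (opens U)) (t2Space_freeDiffVect U) exists_freeSum_eq

theorem continuous_dfinsupp_apply {ι : Type*} {V : ι → Type*} [∀ i, AddCommGroup (V i)]
    [∀ i, DiffeologicalSpace (V i)] (i : ι) :
    Continuous[dTopology, dTopology] fun v : Π₀ i, V i ↦ v i := by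
  let _ := Classical.decEq ι
  let _ : TopologicalSpace (V i) := dTopology
  refine DiffeologicalSpace.continuous_dTopology_iSup_coinduced _ fun J ↦ ?_
  let _ : TopologicalSpace (∀ j : (↑J : Set ι), V j) := dTopology
  by_cases hi : i ∈ J
  · have h : Continuous fun x : ∀ j : (↑J : Set ι), V j ↦ x ⟨i, hi⟩ := (dSmooth_eval _).continuous
    exact h.congr fun x ↦ (DFinsupp.mk_of_mem hi).symm
  · exact (continuous_const (y := (0 : V i))).congr fun x ↦ (DFinsupp.mk_of_notMem hi).symm

theorem IsCountablyPlotGenerated.dfinsupp {ι : Type} [Countable ι] {V : ι → Type}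
    [∀ i, AddCommGroup (V i)] [∀ i, DiffeologicalSpace (V i)]
    (hV : ∀ i, IsCountablyPlotGenerated (V i)) : IsCountablyPlotGenerated (Π₀ i, V i) := by
  refine iSup_coinduced _ (fun J ↦ pi _ fun j ↦ hV j) ?_ fun v ↦ ?_
  · let _ : TopologicalSpace (Π₀ i, V i) := dTopology
    refine ⟨fun v w hvw ↦ ?_⟩
    obtain ⟨i, hi⟩ := DFinsupp.ne_iff.1 hvw
    let _ : TopologicalSpace (V i) := dTopology
    have := (hV i).1
    exact separated_by_continuous (continuous_dfinsupp_apply i) hi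
  · classical
    refine ⟨v.support, fun j ↦ v j, ?_⟩
    ext i
    by_cases hi : v i = 0 <;> simp [hi]

theorem IsCountablyGeneratedProjective.isCountablyPlotGenerated {P : Type*} [AddCommGroup P]
    [Module ℝ P] [DiffeologicalSpace P] (hP : IsCountablyGeneratedProjective P) :
    IsCountablyPlotGenerated P := by
  obtain ⟨-, ι, _, n, U, Q, e, he, he'⟩ := hP
  refine (IsCountablyPlotGenerated.dfinsupp fun i ↦ .freeDiffVect (U i)).of_retract
    (r := fun v ↦ (e.symm v).1) (s := fun x ↦ e (x, 0)) (dSmooth_fst.comp he') ?_ fun x ↦ by simp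
  exact he.comp fun n p hp ↦ isPlot_prod_iff.2 ⟨hp, isPlot_const⟩

end Diffeology

end DirectSums

/-! ### The main theorem -/

theorem mainTheorem3 {P : Type*} [AddCommGroup P] [Module ℝ P] [DiffeologicalSpace P]
    [IsDiffVectorSpace P] (hP : IsCountablyGeneratedProjective P) :
    letI : TopologicalSpace P := dTopology
    IsKOmegaSpace P ∧ T4Space P ∧ (IsTopologicalAddGroup P ∧ ContinuousSMul ℝ P) ∧
      (dTopology : TopologicalSpace (P × P)) = instTopologicalSpaceProd := by
  let _ : TopologicalSpace P := dTopology
  have hG := hP.isCountablyPlotGenerated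
  have hK : IsKOmegaSpace P := hG.isKOmegaSpace
  have hPP : (dTopology : TopologicalSpace (P × P)) = instTopologicalSpaceProd :=
    hG.dTopology_prod hG
  have hRP : (dTopology : TopologicalSpace (ℝ × P)) = instTopologicalSpaceProd :=
    IsCountablyPlotGenerated.real.dTopology_prod hG
  have hadd : ContinuousAdd P := ⟨by
    rw [← hPP]
    exact IsDiffVectorSpace.dSmooth_add.continuous⟩
  have hsmul : ContinuousSMul ℝ P := ⟨by
    rw [← hRP]
    exact IsDiffVectorSpace.dSmooth_smul.continuous⟩
  have hneg : ContinuousNeg P := ⟨by simpa using continuous_const_smul (T := P) (-1 : ℝ)⟩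
  have hgrp : IsTopologicalAddGroup P := {}
  have hT2 : T2Space P := hK.1
  obtain ⟨-, K, hKc, hKu, -⟩ := id hK
  -- Normality: a topological group is regular, a σ-compact space is Lindelöf, and regular Lindelöf
  -- spaces are normal.
  have hσ : SigmaCompactSpace P := ⟨K, hKc, hKu⟩
  exact ⟨hK, inferInstance, ⟨hgrp, hsmul⟩, hPP⟩
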